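/- Let $\mathbb K$ be an algebraically closed field of characteristic zero (for instance $\mathbb C$), and let $\rho:\mathfrak g\to\mathrm{gl}(V)$ be a finite-dimensional representation of a finite-dimensional Lie algebra $\mathfrak g$ over $\mathbb K$. For $x\in V$ let $R_x:\mathfrak g\to V$ be the linear map $R_x(\xi)=\rho(\xi)x$. A polynomial $f$ on $V$ is called invariant if $R_x^*(df(x))=0$ for all $x\in V$. By Kronecker's theorem, for any two linear maps $A,B:U\to W$ of finite-dimensional spaces there are bases of $U$ and $W$ in which $A$ and $B$ are simultaneously block-diagonal, with blocks of the following kinds, unique up to permutation: Jordan blocks with a finite eigenvalue, $A_i=J(\lambda_0)$, $B_i=\mathrm{Id}$; Jordan blocks with eigenvalue $\infty$, $A_i=\mathrm{Id}$, $B_i=J(0)$; horizontal Kronecker blocks $A_i=(\mathrm{Id}\mid 0)$, $B_i=(0\mid \mathrm{Id})$ of size $\varepsilon\times(\varepsilon+1)$, $\varepsilon\ge 0$; and vertical Kronecker blocks of size $(\eta+1)\times\eta$, $\eta\ge 0$, the transposes of horizontal ones. The numbers $\eta$ of columns of the vertical blocks, with repetitions, are the minimal row indices of the pencil $A+\lambda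 B$. The algebraic type of the pencil consists of the minimal row indices, the minimal column indices (the numbers $\varepsilon$), the number of distinct eigenvalues of Jordan blocks, and the number and sizes of the Jordan blocks for each eigenvalue. There is a non-empty Zariski open subset of $V\times V$ such that the pencils $R_x+\lambda R_a$ with $(x,a)$ in this subset all have the same algebraic type; the minimal row indices of $\rho$ are the minimal row indices $\eta_1(\rho)\le\dots\le\eta_q(\rho)$ of these generic pencils. Let $f_1,\dots,f_m$ be algebraically independent invariant polynomials of $\rho$ with $\deg f_1\le\dots\le\deg f_m$. Then $m\le q$ and $$\deg f_\alpha\ \ge\ \eta_\alpha(\rho)+1\qquad\text{for }\alpha=1,\dots,m.$$ -/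

import Mathlib

/- The Lie bracket on `Module.End K V` is the commutator. -/
attribute [local instance 100] LieRing.ofAssociativeRing

noncomputable section

namespace JordanKronecker

/-- The blocks of the canonical form of a pencil `A + λ B` of linear maps: Jordan blocks with a
finite eigenvalue, Jordan blocks with eigenvalue `∞` (both of positive size), horizontal Kronecker
blocks of size `ε × (ε + 1)` and vertical Kronecker blocks of size `(η + 1) × η`. The block
`horizontal 0` is a zero column, the block `vertical 0` is a zero row. -/
inductive Block (K : Type*) where
  | jordan (eigenvalue : K) (size : ℕ+)
  | jordanInfty (size : ℕ+)
  | horizontal (ε : ℕ)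
  | vertical (η : ℕ)

namespace Block

/-- The number of rows of a block. -/
def rows {K : Type*} : Block K → ℕ
  | jordan _ n => n
  | jordanInfty n => n
  | horizontal ε => ε
  | vertical η => η + 1

/-- The number of columns of a block. -/
def cols {K : Type*} : Block K → ℕ
  | jordan _ n => n
  | jordanInfty n => n
  | horizontal ε => ε + 1
  | vertical η => η

/-- The matrix `A` of the pair `(A, B)` given by a block. -/
def matA {K : Type*} [Field K] : (b : Block K) → Matrix (Fin b.rows) (Fin b.cols) K
  | jordan c _ => Matrix.of fun i j =>
      if (j : ℕ) = i then c else if (j : ℕ) = i + 1 then 1 else 0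
  | jordanInfty _ => Matrix.of fun i j => if (j : ℕ) = i then 1 else 0
  | horizontal _ => Matrix.of fun i j => if (j : ℕ) = i then 1 else 0
  | vertical _ => Matrix.of fun i j => if (i : ℕ) = j then 1 else 0

/-- The matrix `B` of the pair `(A, B)` given by a block. -/
def matB {K : Type*} [Field K] : (b : Block K) → Matrix (Fin b.rows) (Fin b.cols) K
  | jordan _ _ => Matrix.of fun i j => if (j : ℕ) = i then 1 else 0
  | jordanInfty _ => Matrix.of fun i j => if (j : ℕ) = i + 1 then 1 else 0
  | horizontal _ => Matrix.of fun i j => if (j : ℕ) = i + 1 then 1 else 0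
  | vertical _ => Matrix.of fun i j => if (i : ℕ) = j + 1 then 1 else 0

/-- The eigenvalue (in `K ∪ {∞}`) and the size of a Jordan block. -/
def jordanData {K : Type*} : Block K → Option (OnePoint K × ℕ)
  | jordan c n => some ((c : OnePoint K), (n : ℕ))
  | jordanInfty n => some (OnePoint.infty, (n : ℕ))
  | horizontal _ => none
  | vertical _ => none

/-- The minimal column index of a horizontal Kronecker block: its number of rows. -/
def colIndex {K : Type*} : Block K → Option ℕ
  | horizontal ε => some ε
  | _ => none

/-- The minimal row index of a vertical Kronecker block: its number of columns. -/
def rowIndex {K : Type*} : Block K → Option ℕ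
  | vertical η => some η
  | _ => none

end Block

/-- There are bases of `U` and `W` in which `A` and `B` are simultaneously block-diagonal with the
blocks of the list `L`. -/
def HasCanonicalForm {K U W : Type*} [Field K] [AddCommGroup U] [Module K U]
    [AddCommGroup W] [Module K W] (A B : U →ₗ[K] W) (L : List (Block K)) : Prop :=
  ∃ (u : Module.Basis (Σ i : Fin L.length, Fin (L.get i).cols) K U)
    (w : Module.Basis (Σ i : Fin L.length, Fin (L.get i).rows) K W),
    LinearMap.toMatrix u w A = Matrix.blockDiagonal' (fun i => (L.get i).matA) ∧
    LinearMap.toMatrix u w B = Matrix.blockDiagonal' (fun i => (L.get i).matB)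

/-- The discrete invariants of a pencil: `jordanSizes` has one entry for each distinct eigenvalue,
the multiset of the sizes of the Jordan blocks with this eigenvalue. -/
@[ext]
structure AlgebraicType where
  jordanSizes : Multiset (Multiset ℕ)
  colIndices : Multiset ℕ
  rowIndices : Multiset ℕ

open Classical in
/-- The algebraic type read off from the list of blocks of a canonical form. -/
def typeOfBlocks {K : Type*} (L : List (Block K)) : AlgebraicType where
  jordanSizes :=
    ((L.filterMap Block.jordanData).map Prod.fst).toFinset.val.map fun c =>
      (((L.filterMap Block.jordanData).filter (fun d => d.1 = c)).map Prod.snd : Multiset ℕ)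
  colIndices := (L.filterMap Block.colIndex : Multiset ℕ)
  rowIndices := (L.filterMap Block.rowIndex : Multiset ℕ)

/-- The pencil `A + λ B` has algebraic type `τ`. -/
def HasAlgebraicType {K U W : Type*} [Field K] [AddCommGroup U] [Module K U]
    [AddCommGroup W] [Module K W] (A B : U →ₗ[K] W) (τ : AlgebraicType) : Prop :=
  ∃ L : List (Block K), HasCanonicalForm A B L ∧ typeOfBlocks L = τ

/-- Zariski open subsets of a vector space `W`: the sets where some member of a family of
polynomial functions does not vanish. A polynomial function on `W` is a polynomial expression in
linear functionals on `W`. -/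
def IsZariskiOpen (K : Type*) {W : Type*} [Field K] [AddCommGroup W] [Module K W]
    (S : Set W) : Prop :=
  ∃ F : Set (MvPolynomial (Module.Dual K W) K),
    S = {w | ∃ P ∈ F, MvPolynomial.eval (fun φ : Module.Dual K W => φ w) P ≠ 0}

section Representation

variable {K 𝔤 V : Type*} [Field K] [LieRing 𝔤] [LieAlgebra K 𝔤] [AddCommGroup V] [Module K V]

/-- The operator `R_x : 𝔤 → V`, `R_x ξ = ρ(ξ) x`. -/
def R (ρ : 𝔤 →ₗ⁅K⁆ Module.End K V) (x : V) : 𝔤 →ₗ[K] V :=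
  (ρ : 𝔤 →ₗ[K] Module.End K V).flip x

/-- `τ` is the Jordan--Kronecker invariant of `ρ`: the algebraic type of the pencil `R_x + λ R_a`
is `τ` for all pairs `(x, a)` of some non-empty Zariski open subset of `V × V`. -/
def IsJKInvariant (ρ : 𝔤 →ₗ⁅K⁆ Module.End K V) (τ : AlgebraicType) : Prop :=
  ∃ S : Set (V × V), S.Nonempty ∧ IsZariskiOpen K S ∧
    ∀ p ∈ S, HasAlgebraicType (R ρ p.1) (R ρ p.2) τ

/-- `η 0 ≤ η 1 ≤ … ≤ η (q - 1)` are the minimal row indices of `ρ`, that is, of a generic pencil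
`R_x + λ R_a`. -/
def IsMinimalRowIndices (ρ : 𝔤 →ₗ⁅K⁆ Module.End K V) {q : ℕ} (η : Fin q → ℕ) : Prop :=
  Monotone η ∧ ∃ τ : AlgebraicType, IsJKInvariant ρ τ ∧
    τ.rowIndices = Finset.univ.val.map η

variable {ι : Type*} [Fintype ι]

/-- The differential at `x` of the polynomial function on `V` that is given by `f` in the
coordinates of the basis `b`. -/
def differential (b : Module.Basis ι K V) (f : MvPolynomial ι K) (x : V) : Module.Dual K V :=
  ∑ i, MvPolynomial.eval (fun j => b.repr x j) (MvPolynomial.pderiv i f) • b.coord i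

/-- The polynomial function on `V` given by `f` in the coordinates of `b` is an invariant of `ρ`:
`R_x^* (df(x)) = 0` for all `x`. -/
def IsInvariant (ρ : 𝔤 →ₗ⁅K⁆ Module.End K V) (b : Module.Basis ι K V)
    (f : MvPolynomial ι K) : Prop :=
  ∀ x : V, (R ρ x).dualMap (differential b f x) = 0

end Representation

end JordanKronecker

end

/-! ### Jacobian criterion in characteristic zero -/

open MvPolynomial in
/-- The gradient of a polynomial, as a derivation. -/
noncomputable def MvPolynomial.gradient (K ι : Type*) [Field K] :
    Derivation K (MvPolynomial ι K) (ι → MvPolynomial ι K) where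
  toLinearMap := LinearMap.pi fun j => (pderiv j).toLinearMap
  map_one_eq_zero' := by ext1 j; simp
  leibniz' p q := by ext1 j; simp

@[simp]
theorem MvPolynomial.gradient_apply {K ι : Type*} [Field K] (p : MvPolynomial ι K) (j : ι) :
    MvPolynomial.gradient K ι p j = MvPolynomial.pderiv j p := rfl

/-- The elements that a derivation maps into `N` form a subalgebra. -/
def Derivation.comapSubalgebra {K S M : Type*} [CommRing K] [CommRing S] [Algebra K S]
    [AddCommGroup M] [Module K M] [Module S M] (D : Derivation K S M) (N : Submodule S M) :
    Subalgebra K S where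
  carrier := {p | D p ∈ N}
  mul_mem' {p q} hp hq := by
    simp only [Set.mem_ofPred_eq, Derivation.leibniz] at *
    exact N.add_mem (N.smul_mem _ hq) (N.smul_mem _ hp)
  add_mem' {p q} hp hq := by
    simp only [Set.mem_ofPred_eq, map_add] at *
    exact N.add_mem hp hq
  algebraMap_mem' r := by simp

/-- A nonzero multiple of `D t` lies in `N` if `t` is algebraic over a subalgebra that `D` maps
into `N`. -/
theorem Derivation.exists_smul_mem_of_isAlgebraic {K S M : Type*} [Field K] [CharZero K]
    [CommRing S] [IsDomain S] [Algebra K S] [AddCommGroup M] [Module K M] [Module S M]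
    (D : Derivation K S M) (N : Submodule S M) (A : Subalgebra K S)
    (hA : ∀ p ∈ A, D p ∈ N) (t : S) (ht : IsAlgebraic A t) :
    ∃ d : S, d ≠ 0 ∧ d • D t ∈ N := by
  classical
  -- `A` need not be a field, so a nonzero annihilator of least degree replaces the minimal
  -- polynomial; minimality keeps its derivative from vanishing at `t`.
  have hex : ∃ n, ∃ P : Polynomial A, P ≠ 0 ∧ Polynomial.aeval t P = 0 ∧ P.natDegree = n := by
    obtain ⟨P, h0, h1⟩ := ht
    exact ⟨_, P, h0, h1, rfl⟩
  obtain ⟨P, hP0, hPt, hPn⟩ := Nat.find_spec hex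
  have hmin := fun k (hk : k < Nat.find hex) => Nat.find_min hex hk
  have hCZ : CharZero A := charZero_of_injective_algebraMap (algebraMap K A).injective
  have hdeg : P.natDegree ≠ 0 := by
    intro h
    rw [Polynomial.natDegree_eq_zero] at h
    obtain ⟨c, rfl⟩ := h
    rw [Polynomial.aeval_C] at hPt
    apply hP0
    have : c = 0 := (FaithfulSMul.algebraMap_eq_zero_iff A S).1 hPt
    simp [this]
  have hder0 : Polynomial.derivative P ≠ 0 := by
    intro h
    exact hdeg (Polynomial.derivative_eq_zero.1 h)
  refine ⟨Polynomial.aeval t (Polynomial.derivative P), ?_, ?_⟩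
  · intro h
    exact hmin _ (by rw [← hPn]; exact Polynomial.natDegree_derivative_lt hdeg) ⟨_, hder0, h, rfl⟩
  -- Chain rule modulo `N`: derivatives of the coefficients are absorbed by `N`. For `Q = P` the
  -- first term is zero.
  · have key : ∀ Q : Polynomial A,
        D (Polynomial.aeval t Q) - Polynomial.aeval t (Polynomial.derivative Q) • D t ∈ N := by
      intro Q
      induction Q using Polynomial.induction_on' with
      | add p q hp hq =>
        have := N.add_mem hp hq
        simp only [map_add, add_smul]
        convert this using 1
        abel
      | monomial n a =>
        have h1 : (t ^ n) • D (a : S) ∈ N := N.smul_mem _ (hA _ a.2)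
        convert h1 using 1
        simp only [Polynomial.derivative_monomial, Polynomial.aeval_monomial, Derivation.leibniz,
          Derivation.leibniz_pow, map_mul]
        rw [show algebraMap A S a = (a : S) from rfl, _root_.map_natCast (algebraMap A S),
          ← Nat.cast_smul_eq_nsmul S, smul_smul,
          smul_smul, add_comm, add_sub_assoc, ← sub_smul,
          show (a : S) * (n : S) * t ^ (n - 1) - (a : S) * (n : S) * t ^ (n - 1) = 0 by ring]
        simp
    have := key P
    rw [hPt, map_zero, zero_sub] at this
    simpa using N.neg_mem this

/-- A family of polynomials indexed by the variables that is algebraically generating has a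
nonzero Jacobian determinant. -/
theorem jacobian_det_ne_zero {K ι : Type*} [Field K] [CharZero K] [Fintype ι] [DecidableEq ι]
    (y : ι → MvPolynomial ι K)
    (hy : Algebra.IsAlgebraic (Algebra.adjoin K (Set.range y)) (MvPolynomial ι K)) :
    (Matrix.of fun i j => MvPolynomial.pderiv j (y i)).det ≠ 0 := by
  set J : Matrix ι ι (MvPolynomial ι K) := Matrix.of fun i j => MvPolynomial.pderiv j (y i)
  set N := Submodule.span (MvPolynomial ι K) (Set.range fun i => MvPolynomial.gradient K ι (y i))
  have hA : ∀ p ∈ Algebra.adjoin K (Set.range y), MvPolynomial.gradient K ι p ∈ N := by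
    intro p hp
    have : Algebra.adjoin K (Set.range y) ≤ (MvPolynomial.gradient K ι).comapSubalgebra N := by
      rw [Algebra.adjoin_le_iff]
      rintro _ ⟨i, rfl⟩
      exact Submodule.subset_span ⟨i, rfl⟩
    exact this hp
  have h := fun i => (MvPolynomial.gradient K ι).exists_smul_mem_of_isAlgebraic N _ hA
    (MvPolynomial.X i) (hy.isAlgebraic _)
  choose d hd0 hd using h
  simp only [N, Submodule.mem_span_range_iff_exists_fun] at hd
  choose c hc using hd
  -- Each `d i` times the gradient of `X i` is a combination of the rows of `J`.
  have hM : Matrix.of c * J = Matrix.diagonal d := by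
    ext1 i j
    have := congrFun (hc i) j
    simp only [Finset.sum_apply, Pi.smul_apply, MvPolynomial.gradient_apply, smul_eq_mul] at this
    rw [Matrix.mul_apply, Matrix.diagonal_apply]
    simp only [J, Matrix.of_apply, this, MvPolynomial.pderiv_X, Pi.single_apply]
    split_ifs <;> simp_all
  intro hJ
  have := congrArg Matrix.det hM
  rw [Matrix.det_mul, hJ, mul_zero, Matrix.det_diagonal] at this
  exact Finset.prod_ne_zero_iff.2 (fun i _ => hd0 i) this.symm

/-- The gradients of algebraically independent polynomials are linearly independent at the points
where some nonzero polynomial does not vanish. -/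
theorem AlgebraicIndependent.exists_linearIndependent_pderiv {K ι σ : Type*} [Field K] [CharZero K]
    [Fintype ι] {f : σ → MvPolynomial ι K} (hf : AlgebraicIndependent K f) :
    ∃ D : MvPolynomial ι K, D ≠ 0 ∧ ∀ x : ι → K, MvPolynomial.eval x D ≠ 0 →
      LinearIndependent K fun (α : σ) (j : ι) =>
        MvPolynomial.eval x (MvPolynomial.pderiv j (f α)) := by
  classical
  -- Completing to a transcendence basis, which has as many elements as there are variables, makes
  -- the Jacobian square.
  obtain ⟨s, hs, hst⟩ := exists_isTranscendenceBasis_superset (hf.coe_range)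
  have hcard := hst.lift_cardinalMk_eq (IsTranscendenceBasis.mvPolynomial ι K)
  obtain ⟨e⟩ := Cardinal.lift_mk_eq'.1 hcard
  have hdet := jacobian_det_ne_zero (fun i => (e.symm i : MvPolynomial ι K)) (by
    have := hst.isAlgebraic
    rwa [show Set.range (fun i => (e.symm i : MvPolynomial ι K)) = Set.range ((↑) : s → _) from
      e.symm.surjective.range_comp ((↑) : s → MvPolynomial ι K)])
  refine ⟨_, hdet, fun x hx => ?_⟩
  rw [RingHom.map_det] at hx
  have hrows := Matrix.linearIndependent_rows_of_det_ne_zero hx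
  have hinj : Function.Injective fun α => e ⟨f α, hs ⟨α, rfl⟩⟩ := by
    intro α β h
    exact hf.injective (by simpa using h)
  have h : (fun (α : σ) (j : ι) => MvPolynomial.eval x (MvPolynomial.pderiv j (f α))) =
      (fun i j => MvPolynomial.eval x (MvPolynomial.pderiv j (e.symm i : MvPolynomial ι K))) ∘
        fun α => e ⟨f α, hs ⟨α, rfl⟩⟩ := by
    ext α j
    simp
  rw [h]
  exact hrows.comp _ hinj

/-! ### Degrees of derivatives and restriction to a line -/

theorem MvPolynomial.totalDegree_pderiv_lt {K ι : Type*} [Field K] (f : MvPolynomial ι K) (j : ι)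
    (h : pderiv j f ≠ 0) : (pderiv j f).totalDegree < f.totalDegree := by
  classical
  obtain ⟨u, hu, hdeg⟩ := (pderiv j f).support.exists_mem_eq_sup (by simpa using h)
    fun s => s.sum fun _ e => e
  rw [MvPolynomial.totalDegree, hdeg]
  rw [MvPolynomial.mem_support_iff, coeff_pderiv] at hu
  have := le_totalDegree (p := f) (s := u + Finsupp.single j 1)
    (by rw [MvPolynomial.mem_support_iff]; intro h0; simp [h0] at hu)
  rw [Finsupp.sum_add_index' (by simp) (by simp), Finsupp.sum_single_index rfl] at this
  omega

/-- The restriction of a polynomial to a line, as a polynomial in the parameter. -/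
noncomputable def MvPolynomial.restrictLine {K ι : Type*} [Field K] (x a : ι → K)
    (f : MvPolynomial ι K) : Polynomial K :=
  aeval (fun j => Polynomial.C (x j) + Polynomial.X * Polynomial.C (a j)) f

theorem MvPolynomial.eval_restrictLine {K ι : Type*} [Field K] (x a : ι → K)
    (f : MvPolynomial ι K) (t : K) :
    (restrictLine x a f).eval t = eval (fun j => x j + t * a j) f := by
  induction f using MvPolynomial.induction_on with
  | C c => simp [restrictLine]
  | add p q hp hq => simpa [restrictLine] using congrArg₂ (· + ·) hp hq
  | mul_X p i hp =>
    simp only [restrictLine, map_mul, aeval_X, Polynomial.eval_mul, eval_X] at hp ⊢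
    rw [hp, Polynomial.eval_add, Polynomial.eval_mul, Polynomial.eval_C, Polynomial.eval_C,
      Polynomial.eval_X]

/-- With `degree` the strict bound also covers a zero derivative, whose degree is `⊥`. -/
theorem MvPolynomial.degree_restrictLine_pderiv_lt {K ι : Type*} [Field K] (x a : ι → K)
    (f : MvPolynomial ι K) (j : ι) :
    (restrictLine x a (pderiv j f)).degree < (f.totalDegree : WithBot ℕ) := by
  by_cases h : pderiv j f = 0
  · simp [h, restrictLine]
  · refine (Polynomial.degree_le_natDegree).trans_lt ?_
    have h1 := totalDegree_pderiv_lt f j h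
    have h2 : (restrictLine x a (pderiv j f)).natDegree ≤ (pderiv j f).totalDegree * 1 := by
      refine aeval_natDegree_le _ le_rfl _ fun i => ?_
      rw [add_comm, mul_comm]
      exact Polynomial.natDegree_linear_le
    exact_mod_cast (by omega)

/-! ### Solutions of the transposed pencil on one block -/

namespace JordanKronecker

open Polynomial

/-- A row vector annihilated by columns that form a triangular matrix vanishes. -/
theorem eq_zero_of_triangular {S κ : Type*} [CommRing S] [IsDomain S] {n : ℕ}
    (M : Fin n → κ → S) (φ : Fin n → S) (hφ : ∀ c, ∑ r, M r c * φ r = 0) (c : Fin n → κ)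
    (hdiag : ∀ r, M r (c r) ≠ 0) (htri : ∀ r s, r < s → M s (c r) = 0) (r : Fin n) :
    φ r = 0 := by
  induction r using WellFoundedLT.induction with
  | ind r ih =>
    have h := hφ (c r)
    rw [Finset.sum_eq_single r] at h
    · exact (mul_eq_zero.1 h).resolve_left (hdiag r)
    · intro s _ hs
      obtain hlt | hlt := lt_or_gt_of_ne hs
      · rw [ih s hlt, mul_zero]
      · rw [htri r s hlt, zero_mul]
    · simp

/-- A polynomial solution `φ` of `(A + λ B)ᵀ φ = 0` of degree less than `d` for a single block has
nonzero value at `λ = 0` only in the last row of a vertical block with `η < d`. -/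
theorem Block.eval_zero_ne_zero {K : Type*} [Field K] (b : Block K) (φ : Fin b.rows → K[X])
    (d : ℕ) (hd : ∀ r, (φ r).degree < (d : WithBot ℕ))
    (hφ : ∀ c, ∑ r, (C (b.matA r c) + X * C (b.matB r c)) * φ r = 0)
    (r : Fin b.rows) (hr : (φ r).eval 0 ≠ 0) :
    (∃ η, b.rowIndex = some η ∧ η < d) ∧ (r : ℕ) + 1 = b.rows := by
  cases b with
  | jordan c n =>
    have h : ∀ k : Fin n, ∑ r : Fin n,
        (C (if (k : ℕ) = r then c else if (k : ℕ) = r + 1 then 1 else 0) +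
        X * C (if (k : ℕ) = r then 1 else 0)) * φ r = 0 := hφ
    refine absurd ?_ hr
    rw [eq_zero_of_triangular _ φ h id, eval_zero]
    · intro r
      simpa [add_comm] using X_add_C_ne_zero c
    · intro r s hrs
      have hlt : (r : ℕ) < s := hrs
      simp [hlt.ne, (Nat.lt_succ_of_lt hlt).ne]
  | jordanInfty n =>
    have h : ∀ k : Fin n, ∑ r : Fin n, (C (if (k : ℕ) = r then 1 else 0) +
        X * C (if (k : ℕ) = r + 1 then 1 else 0)) * φ r = 0 := hφ
    refine absurd ?_ hr
    rw [eq_zero_of_triangular _ φ h id, eval_zero]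
    · intro r
      simp
    · intro r s hrs
      have hlt : (r : ℕ) < s := hrs
      simp [hlt.ne, (Nat.lt_succ_of_lt hlt).ne]
  | horizontal ε =>
    have h : ∀ k : Fin (ε + 1), ∑ r : Fin ε, (C (if (k : ℕ) = r then 1 else 0) +
        X * C (if (k : ℕ) = r + 1 then 1 else 0)) * φ r = 0 := hφ
    refine absurd ?_ hr
    -- The first `ε` columns already form a unitriangular matrix.
    rw [eq_zero_of_triangular _ φ h Fin.castSucc, eval_zero]
    · intro r
      simp
    · intro r s hrs
      have hlt : (r : ℕ) < s := hrs
      simp [hlt.ne, (Nat.lt_succ_of_lt hlt).ne]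
  | vertical η =>
    change Fin (η + 1) → K[X] at φ
    change ∀ r : Fin (η + 1), _ at hd
    change Fin (η + 1) at r
    replace hφ : ∀ k : Fin η, ∑ r : Fin (η + 1), (C (if (r : ℕ) = k then 1 else 0) +
        X * C (if (r : ℕ) = k + 1 then 1 else 0)) * φ r = 0 := hφ
    -- Column `k` has entries `1` and `X` in rows `k` and `k + 1`; hence every row but the last
    -- vanishes at `0`.
    have hstep : ∀ k : Fin η, φ k.castSucc = -X * φ k.succ := by
      intro k
      have h : ∀ r : Fin (η + 1), (C (if (r : ℕ) = k then 1 else 0) +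
          X * C (if (r : ℕ) = k + 1 then (1 : K) else 0)) * φ r =
          (if r = k.castSucc then φ r else 0) + (if r = k.succ then X * φ r else 0) := by
        intro r
        simp only [Fin.ext_iff, Fin.val_castSucc, Fin.val_succ]
        split_ifs <;> simp [add_mul]
      have := hφ k
      rw [Finset.sum_congr rfl fun r _ => h r, Finset.sum_add_distrib] at this
      simp only [Finset.sum_ite_eq', Finset.mem_univ, if_true] at this
      linear_combination this
    obtain ⟨j, rfl⟩ | rfl := r.eq_castSucc_or_eq_last
    · simp [hstep] at hr
    refine ⟨⟨η, rfl, ?_⟩, rfl⟩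
    by_contra! hle
    have hpow : ∀ k (hk : k < η + 1), φ 0 = (-X) ^ k * φ ⟨k, hk⟩ := by
      intro k
      induction k with
      | zero => intro _; simp
      | succ k ih =>
        intro hk
        rw [ih (by omega), pow_succ, mul_assoc]
        exact congrArg _ (hstep ⟨k, by omega⟩)
    have h0 := hpow η (Nat.lt_succ_self η)
    have hlast : φ (Fin.last η) ≠ 0 := by
      intro h
      simp [h] at hr
    have hdeg := hd 0
    rw [h0, degree_mul, degree_pow, degree_neg, degree_X] at hdeg
    change η • (1 : WithBot ℕ) + (φ (Fin.last η)).degree < d at hdeg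
    rw [degree_eq_natDegree hlast] at hdeg
    simp only [nsmul_eq_mul, mul_one] at hdeg
    have : η + (φ (Fin.last η)).natDegree < d := by exact_mod_cast hdeg
    omega

/-! ### Counting minimal row indices -/

/-- The number of minimal row indices less than `d`, counted over the blocks. -/
theorem countP_rowIndices {K : Type*} (L : List (Block K)) (d : ℕ) :
    (typeOfBlocks L).rowIndices.countP (· < d) =
      Nat.card {i : Fin L.length // ∃ η, (L.get i).rowIndex = some η ∧ η < d} := by
  classical
  have h1 : (typeOfBlocks L).rowIndices =
      ((List.finRange L.length).filterMap fun i => (L.get i).rowIndex : List ℕ) := by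
    change ((L.filterMap Block.rowIndex : List ℕ) : Multiset ℕ) = _
    conv_lhs => rw [← List.map_get_finRange L, List.filterMap_map]
    rfl
  rw [h1, Multiset.coe_countP, List.countP_filterMap, Nat.card_eq_fintype_card,
    Fintype.card_subtype, Finset.card_def, Finset.filter_val, ← Multiset.countP_eq_card_filter]
  change _ = Multiset.countP _ (List.finRange L.length : Multiset (Fin L.length))
  rw [Multiset.coe_countP]
  congr 1
  ext i
  cases h : (L.get i).rowIndex <;> simp

/-- If more than `k` terms of a nondecreasing finite sequence are less than `d`, then so is the
term with index `k`. -/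
theorem exists_lt_of_lt_card {q : ℕ} (η : Fin q → ℕ) (hη : Monotone η) (k d : ℕ)
    (h : k < (Finset.univ.filter fun i => η i < d).card) : ∃ hk : k < q, η ⟨k, hk⟩ < d := by
  have hk : k < q := h.trans_le ((Finset.card_le_univ _).trans_eq (Fintype.card_fin q))
  refine ⟨hk, ?_⟩
  by_contra! hle
  have hsub : (Finset.univ.filter fun i => η i < d) ⊆ Finset.Iio ⟨k, hk⟩ := by
    intro i hi
    rw [Finset.mem_filter] at hi
    rw [Finset.mem_Iio]
    by_contra! hki
    exact absurd (hle.trans (hη hki)) (by simpa using hi.2)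
  have := Finset.card_le_card hsub
  rw [Fin.card_Iio] at this
  exact absurd this (by simpa using h)

/-- Linear forms that extend to polynomial solutions, of degree less than `d`, of the transposed
pencil are at most as many as the minimal row indices less than `d`. -/
theorem card_le_countP_rowIndices {K U W σ : Type*} [Field K] [Infinite K] [AddCommGroup U]
    [Module K U] [AddCommGroup W] [Module K W] [Fintype σ] {A B : U →ₗ[K] W} {τ : AlgebraicType}
    (hτ : HasAlgebraicType A B τ) (d : ℕ) (φ : σ → W →ₗ[K] K[X])
    (hd : ∀ α w, (φ α w).degree < (d : WithBot ℕ))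
    (hφ : ∀ α u t, (φ α ((A + t • B) u)).eval t = 0)
    (hind : LinearIndependent K fun α => leval 0 ∘ₗ φ α) :
    Fintype.card σ ≤ τ.rowIndices.countP (· < d) := by
  classical
  obtain ⟨L, ⟨u, w, hA, hB⟩, rfl⟩ := hτ
  have hexp : ∀ (T : U →ₗ[K] W) (N), LinearMap.toMatrix u w T = N →
      ∀ M : (i : Fin L.length) → Matrix (Fin (L.get i).rows) (Fin (L.get i).cols) K,
      N = Matrix.blockDiagonal' M → ∀ i c, T (u ⟨i, c⟩) = ∑ r, M i r c • w ⟨i, r⟩ := by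
    rintro T _ hT M rfl i c
    rw [← w.sum_repr (T (u ⟨i, c⟩)), Fintype.sum_sigma, Finset.sum_eq_single i]
    · refine Finset.sum_congr rfl fun r _ => ?_
      rw [← LinearMap.toMatrix_apply, hT, Matrix.blockDiagonal'_apply_eq]
    · intro j _ hj
      refine Finset.sum_eq_zero fun r _ => ?_
      rw [← LinearMap.toMatrix_apply, hT, Matrix.blockDiagonal'_apply_ne _ _ _ hj, zero_smul]
    · simp
  have hblock : ∀ α i, ∀ c, ∑ r, (C ((L.get i).matA r c) + X * C ((L.get i).matB r c)) *
      φ α (w ⟨i, r⟩) = 0 := by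
    intro α i c
    -- Pointwise vanishing gives a polynomial identity because `K` is infinite.
    refine Polynomial.funext fun t => ?_
    rw [eval_zero, ← hφ α (u ⟨i, c⟩) t, LinearMap.add_apply, LinearMap.smul_apply,
      hexp A _ hA (fun i => (L.get i).matA) rfl, hexp B _ hB (fun i => (L.get i).matB) rfl]
    simp only [map_add, map_smul, map_sum, eval_finsetSum, eval_mul, eval_add, eval_C, eval_X,
      eval_smul, smul_eq_mul, Finset.mul_sum, ← Finset.sum_add_distrib]
    exact Finset.sum_congr rfl fun r _ => by ring
  have hzero := fun α i => (L.get i).eval_zero_ne_zero (fun r => φ α (w ⟨i, r⟩)) d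
    (fun r => hd α _) (hblock α i)
  let I := {i : Fin L.length // ∃ η, (L.get i).rowIndex = some η ∧ η < d}
  -- The last-row values at `0` determine the form. The default `0` never occurs, as blocks in `I`
  -- are vertical and have `η + 1` rows.
  let v : σ → I → K := fun α i =>
    if h : 0 < (L.get i).rows then (φ α (w ⟨i, ⟨(L.get i).rows - 1, by omega⟩⟩)).eval 0 else 0
  have hv : LinearIndependent K v := by
    rw [Fintype.linearIndependent_iff] at hind ⊢
    intro g hg
    apply hind g
    refine w.ext fun ⟨i, r⟩ => ?_
    simp only [LinearMap.sum_apply, LinearMap.smul_apply, LinearMap.comp_apply, leval_apply,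
      LinearMap.zero_apply]
    by_cases hi : (∃ η, (L.get i).rowIndex = some η ∧ η < d) ∧ (r : ℕ) + 1 = (L.get i).rows
    · have h := congrFun hg ⟨i, hi.1⟩
      simp only [Finset.sum_apply, Pi.smul_apply, Pi.zero_apply, v] at h
      have hpos : 0 < (L.get i).rows := by omega
      simp only [dif_pos hpos] at h
      have hr : r = ⟨(L.get i).rows - 1, by omega⟩ := Fin.ext (by
        change (r : ℕ) = (L.get i).rows - 1
        omega)
      rw [hr]
      exact h
    · refine Finset.sum_eq_zero fun α _ => ?_
      by_cases h0 : (φ α (w ⟨i, r⟩)).eval 0 = 0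
      · rw [h0, smul_zero]
      · exact absurd (hzero α i r h0) hi
  have := hv.fintype_card_le_finrank
  rwa [Module.finrank_fintype_fun_eq_card, ← Nat.card_eq_fintype_card (α := I),
    ← countP_rowIndices] at this

/-! ### Generic points and differentials along a line -/

/-- A nonempty Zariski open set of pairs contains a pair whose first entry is not a zero of a given
nonzero polynomial. -/
theorem IsZariskiOpen.exists_mem_eval_ne_zero {K V ι : Type*} [Field K] [Infinite K]
    [AddCommGroup V] [Module K V] [Finite ι] (b : Module.Basis ι K V) {S : Set (V × V)}
    (hS : IsZariskiOpen K S) (hne : S.Nonempty) {D : MvPolynomial ι K} (hD : D ≠ 0) :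
    ∃ p ∈ S, MvPolynomial.eval (b.repr p.1) D ≠ 0 := by
  obtain ⟨F, rfl⟩ := hS
  obtain ⟨p, P, hPF, hP⟩ := hne
  obtain ⟨y, hy⟩ : ∃ y : ι → K, MvPolynomial.eval y D ≠ 0 := by
    by_contra! h
    exact hD (MvPolynomial.funext fun y => by simpa using h y)
  -- On the line `p + t (z, 0)`, `P` is nonzero at `t = 0` and `D` at `t = 1`, so both are nonzero
  -- at some common `t`.
  let z : V := b.equivFun.symm y - p.1
  let P' := MvPolynomial.restrictLine (fun φ : Module.Dual K (V × V) => φ p)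
    (fun φ => φ (z, 0)) P
  let D' := MvPolynomial.restrictLine (b.repr p.1) (b.repr z) D
  have hP' : P' ≠ 0 := by
    intro h
    have := congrArg (eval 0) h
    simp only [P', MvPolynomial.eval_restrictLine, eval_zero, zero_mul, add_zero] at this
    exact hP this
  have hD' : D' ≠ 0 := by
    intro h
    have := congrArg (eval 1) h
    simp only [D', MvPolynomial.eval_restrictLine, eval_zero, one_mul] at this
    refine hy ?_
    have hyz : (fun j => b.repr p.1 j + b.repr z j) = y := by
      funext j
      rw [← Finsupp.add_apply, ← map_add, add_sub_cancel, ← b.equivFun_apply,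
        LinearEquiv.apply_symm_apply]
    rwa [hyz] at this
  obtain ⟨t, ht⟩ : ∃ t, (P' * D').eval t ≠ 0 := by
    by_contra! h
    exact mul_ne_zero hP' hD' (Polynomial.funext fun t => by rw [h t, eval_zero])
  rw [eval_mul, mul_ne_zero_iff, MvPolynomial.eval_restrictLine,
    MvPolynomial.eval_restrictLine] at ht
  refine ⟨p + t • (z, 0), ⟨P, hPF, ?_⟩, ?_⟩
  · simpa only [map_add, map_smul, smul_eq_mul] using ht.1
  · have h : ⇑(b.repr (p + t • (z, (0 : V))).1) = fun j => b.repr p.1 j + t * b.repr z j := by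
      funext j
      simp
    rw [h]
    exact ht.2

/-- The differentials of `f` at the points of the line `x + λ a`, as a linear map with polynomial
values. -/
noncomputable def differentialOnLine {K V ι : Type*} [Field K] [AddCommGroup V] [Module K V]
    [Fintype ι] (b : Module.Basis ι K V) (f : MvPolynomial ι K) (x a : V) : V →ₗ[K] K[X] :=
  ∑ j, (b.coord j).smulRight
    (MvPolynomial.restrictLine (b.repr x) (b.repr a) (MvPolynomial.pderiv j f))

theorem eval_differentialOnLine {K V ι : Type*} [Field K] [AddCommGroup V] [Module K V]
    [Fintype ι] (b : Module.Basis ι K V) (f : MvPolynomial ι K) (x a w : V) (t : K) :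
    (differentialOnLine b f x a w).eval t = differential b f (x + t • a) w := by
  simp [differentialOnLine, differential, eval_finsetSum, MvPolynomial.eval_restrictLine, mul_comm]

theorem degree_differentialOnLine_lt {K V ι : Type*} [Field K] [AddCommGroup V] [Module K V]
    [Fintype ι] (b : Module.Basis ι K V) (f : MvPolynomial ι K) (x a w : V) :
    (differentialOnLine b f x a w).degree < (f.totalDegree : WithBot ℕ) := by
  rw [differentialOnLine, LinearMap.sum_apply]
  refine (degree_sum_le _ _).trans_lt ((Finset.sup_lt_iff (WithBot.bot_lt_coe _)).2 fun j _ => ?_)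
  exact (degree_smul_le _ _).trans_lt (MvPolynomial.degree_restrictLine_pderiv_lt _ _ f j)

theorem linearIndependent_differential {K V ι σ : Type*} [Field K] [AddCommGroup V] [Module K V]
    [Fintype ι] (b : Module.Basis ι K V) (f : σ → MvPolynomial ι K) (x : V)
    (h : LinearIndependent K fun (α : σ) (j : ι) =>
      MvPolynomial.eval (b.repr x) (MvPolynomial.pderiv j (f α))) :
    LinearIndependent K fun α => differential b (f α) x := by
  classical
  refine LinearIndependent.of_comp (LinearMap.pi fun j => LinearMap.applyₗ (b j)) ?_
  have hcomp : (⇑(LinearMap.pi fun j => LinearMap.applyₗ (b j)) ∘ fun α => differential b (f α) x) =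
      fun (α : σ) (j : ι) => MvPolynomial.eval (b.repr x) (MvPolynomial.pderiv j (f α)) := by
    ext α j
    simp [differential, Finsupp.single_apply]
  rw [hcomp]
  exact h

/-- The number of algebraically independent invariants of degree at most `d` is at most the number
of minimal row indices less than `d`. -/
theorem card_le_countP_of_isInvariant {K 𝔤 V ι σ : Type*} [Field K] [CharZero K]
    [LieRing 𝔤] [LieAlgebra K 𝔤] [AddCommGroup V] [Module K V] [Fintype ι] [Fintype σ]
    (ρ : 𝔤 →ₗ⁅K⁆ Module.End K V) (b : Module.Basis ι K V) (f : σ → MvPolynomial ι K)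
    (hinv : ∀ α, IsInvariant ρ b (f α)) (hind : AlgebraicIndependent K f)
    {d : ℕ} (hd : ∀ α, (f α).totalDegree ≤ d) {τ : AlgebraicType} (hτ : IsJKInvariant ρ τ) :
    Fintype.card σ ≤ τ.rowIndices.countP (· < d) := by
  obtain ⟨S, hne, hS, hST⟩ := hτ
  obtain ⟨D, hD, hDind⟩ := hind.exists_linearIndependent_pderiv
  obtain ⟨⟨x, a⟩, hp, hx⟩ := hS.exists_mem_eval_ne_zero b hne hD
  refine card_le_countP_rowIndices (hST _ hp) d (fun α => differentialOnLine b (f α) x a) ?_ ?_ ?_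
  · exact fun α w => (degree_differentialOnLine_lt b (f α) x a w).trans_le (by exact_mod_cast hd α)
  · intro α ξ t
    rw [eval_differentialOnLine]
    have hR : (R ρ x + t • R ρ a) ξ = R ρ (x + t • a) ξ := by simp [R]
    rw [hR]
    exact LinearMap.congr_fun (hinv α (x + t • a)) ξ
  · convert linearIndependent_differential b f x (hDind _ hx) using 1
    ext α w
    simp [eval_differentialOnLine]

end JordanKronecker

theorem mainTheorem2 {K 𝔤 V ι : Type*} [Field K] [IsAlgClosed K] [CharZero K]
    [LieRing 𝔤] [LieAlgebra K 𝔤] [FiniteDimensional K 𝔤]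
    [AddCommGroup V] [Module K V] [FiniteDimensional K V]
    (ρ : 𝔤 →ₗ⁅K⁆ Module.End K V)
    [Fintype ι] (b : Module.Basis ι K V)
    {m : ℕ} (f : Fin m → MvPolynomial ι K)
    (hinv : ∀ α, JordanKronecker.IsInvariant ρ b (f α))
    (hind : AlgebraicIndependent K f)
    (hdeg : Monotone fun α => (f α).totalDegree)
    {q : ℕ} (η : Fin q → ℕ) (hη : JordanKronecker.IsMinimalRowIndices ρ η) :
    ∃ hmq : m ≤ q, ∀ α : Fin m, η (Fin.castLE hmq α) + 1 ≤ (f α).totalDegree := by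
  obtain ⟨hmono, τ, hτ, hrow⟩ := hη
  have key : ∀ α : Fin m, ∃ hk : (α : ℕ) < q, η ⟨α, hk⟩ < (f α).totalDegree := by
    intro α
    refine JordanKronecker.exists_lt_of_lt_card η hmono α _ ?_
    -- The `α + 1` invariants with index at most `α` have degree at most `d = deg f_α`.
    have h := JordanKronecker.card_le_countP_of_isInvariant ρ b
      (fun β : Set.Iic α => f β) (fun β => hinv β) (hind.comp _ Subtype.val_injective)
      (fun β => hdeg β.2) hτ
    rw [hrow, Multiset.countP_map, Fintype.card_Iic, Fin.card_Iic] at h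
    exact h
  have hmq : m ≤ q := by
    by_contra! hlt
    -- Were `q < m`, the index `q` itself would give `q < q`.
    exact absurd (key ⟨q, hlt⟩).1 (lt_irrefl q)
  exact ⟨hmq, fun α => (key α).2⟩
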